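/- Let $\mathbb F_q$ be a finite field with $q$ elements, let $K$ be a field containing $\mathbb F_q$, let $t,s$ be algebraically independent variables over $K$, and put $k=K(t,s)$, with algebraic closure $\overline{k}$. For $g\in k[x]$ let $g^n$ be the $n$-fold composition of $g$, let $k_n(g,0)=k(\{\gamma\in\overline{k} : g^n(\gamma)=0\})$ and $G_n(g,0)=\mathrm{Gal}(k_n(g,0)/k)$. Let $f=x^q+tx+s$ and $L=L_t=x^q+tx$ in $k[x]$. For $n\ge 1$ let $R_n=\mathbb F_q[y]/(y^n)$, which acts on the $\mathbb F_q$-vector space $\ker(L^n)=\{\beta\in\overline{k} : L^n(\beta)=0\}$ with $y$ acting as $L$; for $F\in R_n$ write $F(L)(\beta)$ for the action of $F$ on $\beta$. Let $n\ge 1$ and let $\alpha_n\in\overline{k}$ be a root of $f^n$. Then $$k_n(f,0)=k_n(L_t,0)\cdot k(\alpha_n).$$ Moreover, let $\beta_1,\beta_2,\ldots\in\overline{k}$ be any sequence with $\beta_1\ne 0$, $L(\beta_1)=0$ and $L(\beta_{i+1})=\beta_i$ for all $i\ge 1$. Then $\ker(L^n)\subseteq k_n(f,0)$, for every $\sigma\in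 G_n(f,0)$ there is a unique pair $(G_\sigma,F_\sigma)\in R_n\times R_n^\times$ such that $$\sigma(\alpha_n)=\alpha_n+G_\sigma(L)(\beta_n)\quad\text{and}\quad \sigma(\beta)=F_\sigma(L)(\beta)\ \text{ for all }\beta\in\ker(L^n),$$ and the map $\iota_n\colon\sigma\mapsto(G_\sigma,F_\sigma)$ is an isomorphism of groups $$\iota_n\colon G_n(f,0)\;\xrightarrow{\ \sim\ }\;R_n\rtimes R_n^\times,$$ where $R_n^\times$ acts on the additive group of $R_n$ by multiplication. -/

import Mathlib

open Polynomial IntermediateField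

noncomputable section

/-! ### Iterated preimages, dynamical fields and dynamical Galois groups -/

/-- The set `f⁻ⁿ(c) = {γ : fⁿ(γ) = c}` in the algebraic closure of `k`, where `fⁿ` is the `n`-fold
composition of `f` (and `f⁰ = X`). -/
def dynPreimage {k : Type*} [Field k] (f : k[X]) (n : ℕ) (c : k) : Set (AlgebraicClosure k) :=
  {γ | aeval γ (f.comp^[n] X) = algebraMap k (AlgebraicClosure k) c}

/-- The `n`-th dynamical field `k_n(f, c) = k(f⁻ⁿ(c))`. -/
def dynField {k : Type*} [Field k] (f : k[X]) (n : ℕ) (c : k) :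
    IntermediateField k (AlgebraicClosure k) :=
  adjoin k (dynPreimage f n c)

/-- The `n`-th dynamical Galois group `G_n(f, c) = Gal(k_n(f, c) / k)`. -/
abbrev dynGal {k : Type*} [Field k] (f : k[X]) (n : ℕ) (c : k) : Type _ :=
  dynField f n c ≃ₐ[k] dynField f n c

/-! ### The polynomials `L = x^q + a x` and `f = x^q + a x + b`, where `q = #F` -/

/-- `L_a = x^q + a x`, with `q` the cardinality of the finite field `F`. -/
def carlitzPoly (F : Type*) [Fintype F] {k : Type*} [Field k] (a : k) : k[X] :=
  X ^ Fintype.card F + C a * X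

/-- `f_{a,b} = x^q + a x + b`, with `q` the cardinality of the finite field `F`. -/
def affinePoly (F : Type*) [Fintype F] {k : Type*} [Field k] (a b : k) : k[X] :=
  X ^ Fintype.card F + C a * X + C b

section Torsion

variable (F : Type*) [Field F] [Fintype F] {k : Type*} [Field k] [Algebra F k]

/-- `L_a` as an `F`-linear endomorphism `z ↦ z^q + a z` of the algebraic closure of `k`. -/
def carlitzEnd (a : k) : Module.End F (AlgebraicClosure k) where
  toFun z := z ^ Fintype.card F + algebraMap k (AlgebraicClosure k) a * z
  map_add' x y := by
    have h := map_add (FiniteField.frobeniusAlgHom F (AlgebraicClosure k)) x y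
    simp only [FiniteField.coe_frobeniusAlgHom] at h
    rw [h]; ring
  map_smul' c x := by
    rw [_root_.smul_pow, FiniteField.pow_card, mul_smul_comm, RingHom.id_apply, smul_add]

theorem carlitzEnd_apply (a : k) (z : AlgebraicClosure k) :
    carlitzEnd F a z = z ^ Fintype.card F + algebraMap k (AlgebraicClosure k) a * z := rfl

theorem carlitzEnd_eq_aeval (a : k) (z : AlgebraicClosure k) :
    carlitzEnd F a z = aeval z (carlitzPoly F a) := by
  simp [carlitzEnd_apply, carlitzPoly]

/-- `ker(Lⁿ)`, the `F`-space of roots of `Lⁿ` in the algebraic closure of `k`. -/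
def carlitzTorsion (a : k) (n : ℕ) : Submodule F (AlgebraicClosure k) :=
  LinearMap.ker (carlitzEnd F a ^ n)

theorem aeval_comp_iterate (f : k[X]) (n : ℕ) (z : AlgebraicClosure k) :
    aeval z (f.comp^[n] X) = (fun w => aeval w f)^[n] z := by
  induction n with
  | zero => simp
  | succ n ih => rw [Function.iterate_succ_apply', Function.iterate_succ_apply', aeval_comp, ih]

theorem carlitzEnd_pow_apply (a : k) (n : ℕ) (z : AlgebraicClosure k) :
    (carlitzEnd F a ^ n) z = aeval z ((carlitzPoly F a).comp^[n] X) := by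
  rw [aeval_comp_iterate, Module.End.pow_apply]
  congr 2
  funext w
  exact carlitzEnd_eq_aeval F a w

theorem mem_carlitzTorsion_iff (a : k) (n : ℕ) (z : AlgebraicClosure k) :
    z ∈ carlitzTorsion F a n ↔ z ∈ dynPreimage (carlitzPoly F a) n 0 := by
  simp [carlitzTorsion, dynPreimage, carlitzEnd_pow_apply]

theorem aeval_affinePoly_iterate_add (a b : k) (n : ℕ) (x z : AlgebraicClosure k) :
    aeval (x + z) ((affinePoly F a b).comp^[n] X) =
      aeval x ((affinePoly F a b).comp^[n] X) + (carlitzEnd F a ^ n) z := by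
  have key (w : AlgebraicClosure k) : aeval w (affinePoly F a b) =
      carlitzEnd F a w + algebraMap k (AlgebraicClosure k) b := by
    simp [carlitzEnd_apply, affinePoly]
  induction n with
  | zero => simp
  | succ n ih =>
    rw [Function.iterate_succ_apply', aeval_comp, aeval_comp, ih, key, key, map_add, pow_succ',
      Module.End.mul_apply]
    ring

/-- Every root of `Lⁿ` is a difference of roots of `fⁿ`, so it lies in `k_n(f, 0)`. -/
theorem mem_dynField_of_mem_carlitzTorsion (a b : k) (n : ℕ) {α : AlgebraicClosure k}
    (hα : α ∈ dynPreimage (affinePoly F a b) n 0) (z : carlitzTorsion F a n) :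
    (z : AlgebraicClosure k) ∈ dynField (affinePoly F a b) n 0 := by
  have hz : (carlitzEnd F a ^ n) (z : AlgebraicClosure k) = 0 := z.2
  have h : α + z ∈ dynPreimage (affinePoly F a b) n 0 := by
    have hα' := hα
    simp only [dynPreimage, Set.mem_ofPred_eq] at hα' ⊢
    rw [aeval_affinePoly_iterate_add, hz, hα', add_zero]
  have h2 := sub_mem (subset_adjoin k _ h) (subset_adjoin k _ hα)
  rwa [add_sub_cancel_left] at h2

theorem mem_dynField_of_mem_dynPreimage {f : k[X]} {n : ℕ} {c : k} {α : AlgebraicClosure k}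
    (hα : α ∈ dynPreimage f n c) : α ∈ dynField f n c :=
  subset_adjoin k _ hα

/-- A sequence `β₁, β₂, …` with `L(β₁) = 0`, `β₁ ≠ 0` and `L(β_{i+1}) = β_i` for `i ≥ 1`
(the value `β 0` plays no role). -/
structure IsTorsionTower (a : k) (β : ℕ → AlgebraicClosure k) : Prop where
  map_one : carlitzEnd F a (β 1) = 0
  one_ne_zero : β 1 ≠ 0
  map_succ : ∀ i, 1 ≤ i → carlitzEnd F a (β (i + 1)) = β i

theorem IsTorsionTower.mem {F : Type*} [Field F] [Fintype F] [Algebra F k] {a : k}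
    {β : ℕ → AlgebraicClosure k} (h : IsTorsionTower F a β) {n : ℕ} (hn : 1 ≤ n) :
    β n ∈ carlitzTorsion F a n := by
  induction n, hn using Nat.le_induction with
  | base => simpa [carlitzTorsion] using h.map_one
  | succ n hn ih =>
    simp only [carlitzTorsion, LinearMap.mem_ker] at ih ⊢
    rw [pow_succ, Module.End.mul_apply, h.map_succ n hn, ih]

/-! ### The ring `R_n = F[y]/(yⁿ)`, its action on `ker(Lⁿ)`, and `R_n ⋊ R_n^×` -/

/-- `R_n = F[y]/(yⁿ)`. -/
abbrev TruncPoly (n : ℕ) : Type _ := F[X] ⧸ Ideal.span {(X ^ n : F[X])}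

/-- `L` restricted to `ker(Lⁿ)`. -/
def carlitzTorsionEnd (a : k) (n : ℕ) : Module.End F (carlitzTorsion F a n) :=
  (carlitzEnd F a).restrict fun z hz => by
    simp only [carlitzTorsion, LinearMap.mem_ker] at hz ⊢
    rw [← Module.End.mul_apply, ← pow_succ, pow_succ', Module.End.mul_apply, hz, map_zero]

theorem carlitzTorsionEnd_pow (a : k) (n : ℕ) : carlitzTorsionEnd F a n ^ n = 0 := by
  ext z
  rw [carlitzTorsionEnd, Module.End.pow_restrict]
  exact z.2

/-- The action of `R_n = F[y]/(yⁿ)` on `ker(Lⁿ)`, with `y` acting as `L`: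
the class of `P` sends `z` to `P(L)(z)`. -/
def torsionAction (a : k) (n : ℕ) :
    TruncPoly F n →+* Module.End F (carlitzTorsion F a n) :=
  Ideal.Quotient.lift _ (aeval (carlitzTorsionEnd F a n)).toRingHom (by
    have : Ideal.span {(X ^ n : F[X])} ≤
        RingHom.ker (aeval (carlitzTorsionEnd F a n)).toRingHom := by
      rw [Ideal.span_le, Set.singleton_subset_iff]
      simp [RingHom.mem_ker, carlitzTorsionEnd_pow]
    exact fun P hP => this hP)

theorem torsionAction_mk (a : k) (n : ℕ) (P : F[X]) (z : carlitzTorsion F a n) :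
    (torsionAction F a n (Ideal.Quotient.mk _ P) z : AlgebraicClosure k) =
      aeval (carlitzEnd F a) P (z : AlgebraicClosure k) := by
  have h : torsionAction F a n (Ideal.Quotient.mk _ P) = aeval (carlitzTorsionEnd F a n) P := rfl
  have hpow (m : ℕ) : (((carlitzTorsionEnd F a n ^ m) z : carlitzTorsion F a n) :
      AlgebraicClosure k) = (carlitzEnd F a ^ m) (z : AlgebraicClosure k) := by
    rw [carlitzTorsionEnd, Module.End.pow_restrict]
    rfl
  rw [h, aeval_endomorphism, aeval_endomorphism, Polynomial.sum, Polynomial.sum]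
  simp [hpow]

/-- The multiplication action of the unit group `R^×` on the additive group of `R`. -/
def unitsMulAut (R : Type*) [CommRing R] : Rˣ →* MulAut (Multiplicative R) :=
  (MulAutMultiplicative R).symm.toMonoidHom.comp (AddAut.mulLeft (R := R))

/-- The group `R_n ⋊ R_n^×`. -/
abbrev AffineTrunc (n : ℕ) : Type _ :=
  Multiplicative (TruncPoly F n) ⋊[unitsMulAut (TruncPoly F n)] (TruncPoly F n)ˣ

/-- The defining relation of the map `ι_n`, for `f = x^q + a x + b`, a root `α` of `fⁿ` and
`β_n ∈ ker(Lⁿ)`: the element `(G, u)` of `R_n ⋊ R_n^×` is attached to `σ ∈ G_n(f, 0)` when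
`σ(α) = α + G(L)(β_n)` and `σ(z) = u(L)(z)` for all `z ∈ ker(Lⁿ)`. -/
structure IsIota {a b : k} {n : ℕ} {α : AlgebraicClosure k}
    (hα : α ∈ dynPreimage (affinePoly F a b) n 0) (βn : carlitzTorsion F a n)
    (σ : dynGal (affinePoly F a b) n 0) (x : AffineTrunc F n) : Prop where
  map_root : (σ ⟨α, mem_dynField_of_mem_dynPreimage hα⟩ : AlgebraicClosure k) =
    α + torsionAction F a n (Multiplicative.toAdd x.left) βn
  map_torsion : ∀ z : carlitzTorsion F a n,
    (σ ⟨z, mem_dynField_of_mem_carlitzTorsion F a b n hα z⟩ : AlgebraicClosure k) =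
      torsionAction F a n (x.right : TruncPoly F n) z

end Torsion

/-! ### The generic case -/

/-- The field `K(t, s)` of rational functions in two variables. -/
abbrev RatFuncTS (K : Type*) [Field K] : Type _ := FractionRing (MvPolynomial (Fin 2) K)

/-- The variable `t` of `K(t, s)`. -/
def varT (K : Type*) [Field K] : RatFuncTS K := algebraMap (MvPolynomial (Fin 2) K) _ (.X 0)

/-- The variable `s` of `K(t, s)`. -/
def varS (K : Type*) [Field K] : RatFuncTS K := algebraMap (MvPolynomial (Fin 2) K) _ (.X 1)

end

open Polynomial IntermediateField

noncomputable section

/-! Write `n = m + 1`. The roots of `fⁿ` form the coset `α + ker Lⁿ`, and `ker Lⁿ` is free of rank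
one over `R_n` on `β_n`: the annihilator of `β_n` is `(yⁿ)`, and `R_n` has at least as many elements
as `Lⁿ` has roots (`torsionAction_bijective`). Galois commutes with `L`, so each `σ` is an affine
map `(G, F)`. This gives an injective homomorphism.

Surjectivity needs two inputs. For the `F`-part, `Lⁿ / Lᵐ` is Eisenstein at `t`, and the unit
multiples of `β_n` are roots of it, so Galois permutes them transitively. For the `G`-part, one
element `(G, 1)` with `G` a unit is enough: conjugation yields all `(v, 1)` with `v` a unit, and in
the local ring `R_n` the units generate everything additively
(`Subgroup.eq_top_of_units_semidirect`).

Such an element exists once `γ = fᵐ(α)`, a root of `f`, lies outside `k(β_n)`. Since `s = -(γ^q +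
tγ)`, the field `k(γ) = K(t, γ)` is again rational, isomorphic to `k` with `t` fixed, so `Lⁿ / Lᵐ`
stays irreducible over it. If `γ` were in `k(β_n)`, comparing degrees would give `γ ∈ k`, but `f`
has no root in `k`. -/

theorem Polynomial.Monic.irreducible_of_map_mk_eq_X_pow {R : Type*} [CommRing R] [IsDomain R]
    {π : R} (hπ : Prime π) {p : R[X]} (hp : p.Monic) (h0 : p.natDegree ≠ 0)
    (hmap : p.map (Ideal.Quotient.mk (Ideal.span {π})) = X ^ p.natDegree)
    (hc : p.coeff 0 = π) : Irreducible p := by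
  have hprime : (Ideal.span {π}).IsPrime := (Ideal.span_singleton_prime hπ.ne_zero).2 hπ
  refine (hp.isEisensteinAt_of_mem_of_notMem hprime.ne_top (fun {m} hm => ?_) ?_).irreducible
    hprime hp.isPrimitive (Nat.pos_of_ne_zero h0)
  · rw [← Ideal.Quotient.eq_zero_iff_mem, ← coeff_map, hmap, coeff_X_pow, if_neg hm.ne]
  · rw [hc, Ideal.span_singleton_pow, Ideal.mem_span_singleton]
    rintro ⟨c, h⟩
    refine hπ.not_isUnit (IsUnit.of_mul_eq_one c (mul_left_cancel₀ hπ.ne_zero ?_))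
    rw [← mul_assoc, ← sq, ← h, mul_one]

/-! ### Iterates of `x^q + a x` and their Eisenstein quotients -/

section Iterate

variable {R : Type*} [CommRing R]

/-- The `n`-th iterate of `x^q + a x` over a commutative ring. -/
def linIter (q : ℕ) (a : R) (n : ℕ) : R[X] := (X ^ q + C a * X).comp^[n] X

/-- The quotient `L^{n+1}(x) / Lⁿ(x) = Lⁿ(x)^{q-1} + a`, for `L = x^q + a x`. -/
def linIterQuot (q : ℕ) (a : R) (n : ℕ) : R[X] := linIter q a n ^ (q - 1) + C a

theorem linIter_succ (q : ℕ) (a : R) (n : ℕ) :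
    linIter q a (n + 1) = linIter q a n ^ q + C a * linIter q a n := by
  rw [linIter, Function.iterate_succ_apply']
  simp [linIter]

theorem map_linIter {S : Type*} [CommRing S] (φ : R →+* S) (q : ℕ) (a : R) (n : ℕ) :
    (linIter q a n).map φ = linIter q (φ a) n := by
  induction n with
  | zero => simp [linIter]
  | succ n ih => rw [linIter_succ, linIter_succ, ← ih]; simp

theorem map_linIterQuot {S : Type*} [CommRing S] (φ : R →+* S) (q : ℕ) (a : R) (n : ℕ) :
    (linIterQuot q a n).map φ = linIterQuot q (φ a) n := by
  simp [linIterQuot, map_linIter]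

theorem linIter_zero_right {q : ℕ} (n : ℕ) : linIter q (0 : R) n = X ^ q ^ n := by
  induction n with
  | zero => simp [linIter]
  | succ n ih => rw [linIter_succ, ih, pow_succ q, pow_mul]; simp

theorem linIter_coeff_zero {q : ℕ} (hq : q ≠ 0) (a : R) (n : ℕ) : (linIter q a n).coeff 0 = 0 := by
  rw [coeff_zero_eq_eval_zero]
  induction n with
  | zero => simp [linIter]
  | succ n ih => rw [linIter_succ]; simp [ih, hq]

theorem monic_X_pow_add_C_mul_X [Nontrivial R] {q : ℕ} (hq : 2 ≤ q) (a : R) :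
    (X ^ q + C a * X).Monic :=
  monic_X_pow_add ((degree_C_mul_X_le a).trans_lt (by exact_mod_cast hq))

theorem natDegree_X_pow_add_C_mul_X [Nontrivial R] {q : ℕ} (hq : 2 ≤ q) (a : R) :
    (X ^ q + C a * X).natDegree = q := by
  rw [natDegree_add_eq_left_of_degree_lt, natDegree_X_pow]
  rw [degree_X_pow]
  exact (degree_C_mul_X_le a).trans_lt (by exact_mod_cast hq)

variable [IsDomain R]

theorem natDegree_linIter {q : ℕ} (hq : 2 ≤ q) (a : R) (n : ℕ) :
    (linIter q a n).natDegree = q ^ n := by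
  rw [linIter, natDegree_iterate_comp, natDegree_X_pow_add_C_mul_X hq, natDegree_X, mul_one]

theorem monic_linIter {q : ℕ} (hq : 2 ≤ q) (a : R) (n : ℕ) : (linIter q a n).Monic := by
  induction n with
  | zero => simp [linIter]
  | succ n ih =>
    rw [linIter, Function.iterate_succ_apply']
    refine (monic_X_pow_add_C_mul_X hq a).comp ih ?_
    rw [← linIter, natDegree_linIter hq]
    positivity

theorem degree_C_lt_linIter_pow {q : ℕ} (hq : 2 ≤ q) (a : R) (n : ℕ) :
    (C a).degree < (linIter q a n ^ (q - 1)).degree := by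
  refine degree_C_le.trans_lt (natDegree_pos_iff_degree_pos.1 ?_)
  rw [natDegree_pow, natDegree_linIter hq]
  exact Nat.mul_pos (by omega) (by positivity)

theorem natDegree_linIterQuot {q : ℕ} (hq : 2 ≤ q) (a : R) (n : ℕ) :
    (linIterQuot q a n).natDegree = (q - 1) * q ^ n := by
  rw [linIterQuot, natDegree_add_eq_left_of_degree_lt (degree_C_lt_linIter_pow hq a n),
    natDegree_pow, natDegree_linIter hq]

theorem monic_linIterQuot {q : ℕ} (hq : 2 ≤ q) (a : R) (n : ℕ) : (linIterQuot q a n).Monic :=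
  ((monic_linIter hq a n).pow _).add_of_left (degree_C_lt_linIter_pow hq a n)

/-- Eisenstein at `a`: modulo `a` the iterate becomes a pure power of `X`, while the constant term
is exactly `a`. -/
theorem irreducible_linIterQuot {q : ℕ} (hq : 2 ≤ q) {a : R} (ha : Prime a) (n : ℕ) :
    Irreducible (linIterQuot q a n) := by
  refine (monic_linIterQuot hq a n).irreducible_of_map_mk_eq_X_pow ha ?_ ?_ ?_
  · rw [natDegree_linIterQuot hq]
    exact (Nat.mul_pos (by omega) (by positivity)).ne'
  · rw [map_linIterQuot, natDegree_linIterQuot hq,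
      Ideal.Quotient.eq_zero_iff_mem.2 (Ideal.mem_span_singleton_self a), linIterQuot,
      linIter_zero_right, C_0, add_zero, ← pow_mul, mul_comm]
  · rw [linIterQuot, coeff_add, coeff_C_zero, coeff_zero_eq_eval_zero, eval_pow,
      ← coeff_zero_eq_eval_zero, linIter_coeff_zero (by omega), zero_pow (by omega), zero_add]

end Iterate

theorem carlitzPoly_iterate (F : Type*) [Fintype F] {k : Type*} [Field k] (a : k) (n : ℕ) :
    (carlitzPoly F a).comp^[n] X = linIter (Fintype.card F) a n := rfl

section Affine

variable (F : Type*) [Field F] [Fintype F]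

theorem natDegree_affinePoly {k : Type*} [Field k] (a b : k) :
    (affinePoly F a b).natDegree = Fintype.card F := by
  rw [affinePoly, natDegree_add_C, natDegree_X_pow_add_C_mul_X Fintype.one_lt_card]

theorem derivative_affinePoly {k : Type*} [Field k] [Algebra F k] (a b : k) :
    derivative (affinePoly F a b) = C a := by
  have : (Fintype.card F : k) = 0 := by
    rw [← map_natCast (algebraMap F k), Nat.cast_card_eq_zero, map_zero]
  rw [affinePoly, derivative_add, derivative_add, derivative_X_pow, this]
  simp

theorem separable_affinePoly {k : Type*} [Field k] [Algebra F k] {a : k} (ha : a ≠ 0) (b : k) :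
    (affinePoly F a b).Separable := by
  rw [Separable, derivative_affinePoly]
  exact isCoprime_one_right.of_isCoprime_of_dvd_right (isUnit_C.2 ha.isUnit).dvd

end Affine

/-! ### Units and cardinality of `R_n` -/

section TruncPoly

variable {F : Type*} [Field F]

theorem TruncPoly.isUnit_mk {n : ℕ} {P : F[X]} (hP : P.coeff 0 ≠ 0) :
    IsUnit (Ideal.Quotient.mk (Ideal.span {(X ^ n : F[X])}) P) := by
  have h : IsCoprime P X :=
    (irreducible_X.coprime_iff_not_dvd.2 (mt X_dvd_iff.1 hP)).symm
  obtain ⟨u, v, huv⟩ := h.pow_right (n := n)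
  refine IsUnit.of_mul_eq_one (Ideal.Quotient.mk _ u) ?_
  rw [← map_mul, ← map_one (Ideal.Quotient.mk _), Ideal.Quotient.eq, Ideal.mem_span_singleton]
  exact ⟨-v, by rw [← huv]; ring⟩

/-- This is the form in which locality of `R_n` is used later: every element is a unit, or a unit
plus one. -/
theorem TruncPoly.isUnit_or_isUnit_sub_one {n : ℕ} (r : TruncPoly F n) :
    IsUnit r ∨ IsUnit (r - 1) := by
  obtain ⟨P, rfl⟩ := Ideal.Quotient.mk_surjective r
  by_cases hP : P.coeff 0 = 0
  · right
    rw [← map_one (Ideal.Quotient.mk _), ← map_sub]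
    exact isUnit_mk (by simp [hP])
  · exact Or.inl (isUnit_mk hP)

theorem TruncPoly.card [Fintype F] (n : ℕ) :
    Nat.card (TruncPoly F n) = Fintype.card F ^ n := by
  have hfin : Module.Finite F (TruncPoly F n) := (monic_X_pow n).finite_quotient
  rw [Module.natCard_eq_pow_finrank (K := F), finrank_quotient_span_eq_natDegree, natDegree_X_pow,
    Nat.card_eq_fintype_card]

instance TruncPoly.instFinite [Finite F] (n : ℕ) : Finite (TruncPoly F n) := by
  have hfin : Module.Finite F (TruncPoly F n) := (monic_X_pow n).finite_quotient
  exact Module.finite_of_finite F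

end TruncPoly

/-! ### `ker Lⁿ` as a free `R_n`-module of rank one -/

section Torsion

variable {F : Type*} [Field F] [Fintype F] {k : Type*} [Field k] [Algebra F k] {a : k}

theorem finite_carlitzTorsion (n : ℕ) : (carlitzTorsion F a n : Set (AlgebraicClosure k)).Finite ∧
    Nat.card (carlitzTorsion F a n) ≤ Fintype.card F ^ n := by
  set p : k[X] := linIter (Fintype.card F) a n
  have hp : p ≠ 0 := (monic_linIter Fintype.one_lt_card a n).ne_zero
  have hset : (carlitzTorsion F a n : Set (AlgebraicClosure k)) =
      p.rootSet (AlgebraicClosure k) := by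
    ext z
    rw [SetLike.mem_coe, mem_carlitzTorsion_iff, mem_rootSet]
    simp [dynPreimage, carlitzPoly_iterate, hp, p]
  refine ⟨hset ▸ p.rootSet_finite _, ?_⟩
  have := p.ncard_rootSet_le (AlgebraicClosure k)
  rw [← hset, natDegree_linIter Fintype.one_lt_card] at this
  exact this

instance carlitzTorsion.instFinite (n : ℕ) : Finite (carlitzTorsion F a n) :=
  (finite_carlitzTorsion n).1.to_subtype

namespace IsTorsionTower

variable {β : ℕ → AlgebraicClosure k} (hβ : IsTorsionTower F a β)
include hβ

theorem carlitzEnd_pow_apply_succ (m : ℕ) : (carlitzEnd F a ^ m) (β (m + 1)) = β 1 := by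
  induction m with
  | zero => simp
  | succ m ih => rw [pow_succ, Module.End.mul_apply, hβ.map_succ _ (by omega), ih]

theorem aeval_eq_zero_iff (m : ℕ) (P : F[X]) :
    aeval (carlitzEnd F a) P (β (m + 1)) = 0 ↔ X ^ (m + 1) ∣ P := by
  classical
  have htop : (carlitzEnd F a ^ (m + 1)) (β (m + 1)) = 0 := hβ.mem (Nat.le_add_left 1 m)
  constructor
  · intro h
    -- By Bézout the gcd also kills `β_{m+1}`. It is a power of `X` up to a unit; an exponent at
    -- most `m` would force `Lᵐ(β_{m+1}) = β_1 = 0`.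
    have hg : aeval (carlitzEnd F a) (EuclideanDomain.gcd P (X ^ (m + 1))) (β (m + 1)) = 0 := by
      rw [EuclideanDomain.gcd_eq_gcd_ab, mul_comm P, mul_comm (X ^ (m + 1)), map_add, map_mul,
        map_mul, LinearMap.add_apply, Module.End.mul_apply, Module.End.mul_apply, h, map_zero,
        map_pow, aeval_X, htop, map_zero, add_zero]
    obtain ⟨j, hj, hassoc⟩ := (dvd_prime_pow prime_X _).1
      (EuclideanDomain.gcd_dvd_right P (X ^ (m + 1)))
    rcases hj.eq_or_lt with rfl | hlt
    · exact hassoc.symm.dvd.trans (EuclideanDomain.gcd_dvd_left _ _)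
    · exfalso
      obtain ⟨c, hc⟩ := hassoc.dvd.trans (pow_dvd_pow X (Nat.le_of_lt_succ hlt))
      refine hβ.one_ne_zero ?_
      rw [← hβ.carlitzEnd_pow_apply_succ m, ← aeval_X (R := F) (carlitzEnd F a), ← map_pow, hc,
        mul_comm, map_mul, Module.End.mul_apply, hg, map_zero]
  · rintro ⟨c, rfl⟩
    rw [mul_comm, map_mul, Module.End.mul_apply, map_pow, aeval_X, htop, map_zero]

/-- Injectivity is the computation of the annihilator; surjectivity then follows by counting, since
`Lⁿ` has at most `qⁿ` roots. -/
theorem torsionAction_bijective (m : ℕ) : Function.Bijective fun r : TruncPoly F (m + 1) =>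
    torsionAction F a (m + 1) r ⟨β (m + 1), hβ.mem (Nat.le_add_left 1 m)⟩ := by
  refine Function.Injective.bijective_of_nat_card_le ?_ ?_
  · intro r r' h
    obtain ⟨P, rfl⟩ := Ideal.Quotient.mk_surjective r
    obtain ⟨Q, rfl⟩ := Ideal.Quotient.mk_surjective r'
    have h' := congrArg (Subtype.val) h
    dsimp only at h'
    rw [torsionAction_mk, torsionAction_mk, ← sub_eq_zero, ← LinearMap.sub_apply, ← map_sub,
      hβ.aeval_eq_zero_iff] at h'
    rwa [Ideal.Quotient.eq, Ideal.mem_span_singleton]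
  · rw [TruncPoly.card]
    exact (finite_carlitzTorsion _).2

/-- Applying `Lᵐ` to `P(L)(β_{m+1})` leaves only `P(0) β_1`, and the class of `P` is a unit exactly
when `P(0) ≠ 0`. -/
theorem isUnit_iff (m : ℕ) (r : TruncPoly F (m + 1)) :
    IsUnit r ↔ (carlitzEnd F a ^ m) (torsionAction F a (m + 1) r
      ⟨β (m + 1), hβ.mem (Nat.le_add_left 1 m)⟩ : AlgebraicClosure k) ≠ 0 := by
  obtain ⟨P, rfl⟩ := Ideal.Quotient.mk_surjective r
  have hdvd : (X : F[X]) ^ (m + 1) ∣ X ^ m * P ↔ P.coeff 0 = 0 := by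
    rw [pow_succ, mul_dvd_mul_iff_left (pow_ne_zero m X_ne_zero), X_dvd_iff]
  rw [torsionAction_mk, ← Module.End.mul_apply, ← aeval_X (R := F) (carlitzEnd F a), ← map_pow,
    aeval_X, ← map_mul, Ne, hβ.aeval_eq_zero_iff, hdvd]
  refine ⟨fun h hP => ?_, TruncPoly.isUnit_mk⟩
  -- Otherwise `y` would be both a unit and nilpotent, making the quotient ring zero.
  obtain ⟨c, rfl⟩ := X_dvd_iff.2 hP
  have hX : IsUnit (Ideal.Quotient.mk (Ideal.span {(X ^ (m + 1) : F[X])}) X) :=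
    isUnit_of_dvd_unit ⟨_, map_mul _ _ _⟩ h
  have h0 := hX.pow (m + 1)
  rw [← map_pow, Ideal.Quotient.eq_zero_iff_mem.2 (Ideal.mem_span_singleton_self _),
    isUnit_zero_iff] at h0
  have h1 : Ideal.Quotient.mk (Ideal.span {(X ^ (m + 1) : F[X])}) 1 = 0 := h0.symm
  rw [Ideal.Quotient.eq_zero_iff_mem, Ideal.mem_span_singleton] at h1
  exact not_isUnit_X (isUnit_of_dvd_one ((dvd_pow_self X (Nat.succ_ne_zero m)).trans h1))

end IsTorsionTower

end Torsion

/-! ### The Galois action on `ker Lⁿ` and on the roots of `fⁿ` -/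

section Galois

variable {F : Type*} [Field F] [Fintype F] {k : Type*} [Field k] [Algebra F k] {a b : k}

/-- A root of `L^{n+1}` which is not a root of `Lⁿ` is a root of `L^{n+1} / Lⁿ`. -/
theorem aeval_linIterQuot_eq_zero {m : ℕ} {z : AlgebraicClosure k}
    (hz : z ∈ carlitzTorsion F a (m + 1)) (hz' : (carlitzEnd F a ^ m) z ≠ 0) :
    aeval z (linIterQuot (Fintype.card F) a m) = 0 := by
  have h : (carlitzEnd F a ^ (m + 1)) z = 0 := hz
  rw [pow_succ', Module.End.mul_apply, carlitzEnd_apply] at h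
  refine (mul_eq_zero.1 ?_).resolve_left hz'
  rw [← h, linIterQuot, map_add, map_pow, aeval_C, ← carlitzPoly_iterate, ← carlitzEnd_pow_apply,
    mul_add, mul_pow_sub_one Fintype.card_ne_zero, mul_comm ((carlitzEnd F a ^ m) z)]

theorem algEquiv_carlitzEnd (τ : AlgebraicClosure k ≃ₐ[k] AlgebraicClosure k)
    (z : AlgebraicClosure k) : τ (carlitzEnd F a z) = carlitzEnd F a (τ z) := by
  simp [carlitzEnd_apply]

theorem algEquiv_aeval_carlitzEnd (τ : AlgebraicClosure k ≃ₐ[k] AlgebraicClosure k) (P : F[X])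
    (z : AlgebraicClosure k) :
    τ (aeval (carlitzEnd F a) P z) = aeval (carlitzEnd F a) P (τ z) := by
  have hpow (m : ℕ) (w : AlgebraicClosure k) :
      τ ((carlitzEnd F a ^ m) w) = (carlitzEnd F a ^ m) (τ w) := by
    induction m generalizing w with
    | zero => rfl
    | succ m ih => rw [pow_succ, Module.End.mul_apply, ih, algEquiv_carlitzEnd]; rfl
  have hsmul (c : F) (w : AlgebraicClosure k) : τ (c • w) = c • τ w := by
    rw [← algebraMap_smul k c w, map_smul, algebraMap_smul]
  rw [aeval_endomorphism, aeval_endomorphism, Polynomial.sum, Polynomial.sum, map_sum]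
  simp only [hsmul, hpow]

theorem algEquiv_mem_carlitzTorsion (τ : AlgebraicClosure k ≃ₐ[k] AlgebraicClosure k) {n : ℕ}
    {z : AlgebraicClosure k} (hz : z ∈ carlitzTorsion F a n) : τ z ∈ carlitzTorsion F a n := by
  have h := algEquiv_aeval_carlitzEnd (F := F) (a := a) τ (X ^ n) z
  rw [map_pow, aeval_X, show (carlitzEnd F a ^ n) z = 0 from hz, map_zero] at h
  exact h.symm

theorem algEquiv_torsionAction (τ : AlgebraicClosure k ≃ₐ[k] AlgebraicClosure k) {n : ℕ}
    (r : TruncPoly F n) (z : carlitzTorsion F a n) :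
    τ (torsionAction F a n r z) =
      torsionAction F a n r ⟨τ z, algEquiv_mem_carlitzTorsion τ z.2⟩ := by
  obtain ⟨P, rfl⟩ := Ideal.Quotient.mk_surjective r
  rw [torsionAction_mk, torsionAction_mk, algEquiv_aeval_carlitzEnd]

theorem torsionAction_mul_apply {n : ℕ} (r r' : TruncPoly F n) (z : carlitzTorsion F a n) :
    torsionAction F a n (r * r') z = torsionAction F a n r (torsionAction F a n r' z) := by
  rw [map_mul, Module.End.mul_apply]

omit [Algebra F k] in
theorem iterate_affinePoly_ne_zero (n : ℕ) : (affinePoly F a b).comp^[n] X ≠ 0 := by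
  refine ne_zero_of_natDegree_gt (n := 0) ?_
  rw [natDegree_iterate_comp, natDegree_affinePoly, natDegree_X, mul_one]
  exact pow_pos Fintype.card_pos n

theorem dynPreimage_eq_rootSet {f : k[X]} {n : ℕ} (hf : f.comp^[n] X ≠ 0) :
    dynPreimage f n 0 = (f.comp^[n] X).rootSet (AlgebraicClosure k) := by
  ext z
  simp [dynPreimage, mem_rootSet, hf]

instance normal_dynField (n : ℕ) : Normal k (dynField (affinePoly F a b) n 0) := by
  rw [dynField, dynPreimage_eq_rootSet (iterate_affinePoly_ne_zero n)]
  exact Normal.of_isSplittingField (hFEp := adjoin_rootSet_isSplittingField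
    (IsAlgClosed.splits _))

variable {n : ℕ} {α : AlgebraicClosure k} (hα : α ∈ dynPreimage (affinePoly F a b) n 0)
include hα

theorem mem_dynPreimage_iff_sub_mem {γ : AlgebraicClosure k} :
    γ ∈ dynPreimage (affinePoly F a b) n 0 ↔ γ - α ∈ carlitzTorsion F a n := by
  have h := aeval_affinePoly_iterate_add F a b n α (γ - α)
  have hα' : aeval α ((affinePoly F a b).comp^[n] X) = 0 := by simpa [dynPreimage] using hα
  rw [add_sub_cancel, hα', zero_add] at h
  simp [dynPreimage, h, carlitzTorsion]

omit [Field F] [Algebra F k] in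
theorem algEquiv_mem_dynPreimage (τ : AlgebraicClosure k ≃ₐ[k] AlgebraicClosure k) :
    τ α ∈ dynPreimage (affinePoly F a b) n 0 := by
  simp only [dynPreimage, map_zero, Set.mem_ofPred_eq] at hα ⊢
  rw [aeval_algHom_apply, hα, map_zero]

theorem dynField_affinePoly_eq_sup : dynField (affinePoly F a b) n 0 =
    dynField (carlitzPoly F a) n 0 ⊔ k⟮α⟯ := by
  apply le_antisymm
  · refine adjoin_le_iff.2 fun γ hγ => ?_
    rw [← sub_add_cancel γ α]
    refine add_mem (SetLike.le_def.1 le_sup_left (subset_adjoin k _ ?_))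
      (SetLike.le_def.1 le_sup_right (mem_adjoin_simple_self k α))
    rw [← mem_carlitzTorsion_iff]
    exact (mem_dynPreimage_iff_sub_mem hα).1 hγ
  · refine sup_le (adjoin_le_iff.2 fun z hz => ?_) (adjoin_simple_le_iff.2 ?_)
    · exact mem_dynField_of_mem_carlitzTorsion F a b n hα
        ⟨z, (mem_carlitzTorsion_iff F a n z).2 hz⟩
    · exact mem_dynField_of_mem_dynPreimage hα

theorem isIota_restrictNormalHom_iff (βn : carlitzTorsion F a n)
    (τ : AlgebraicClosure k ≃ₐ[k] AlgebraicClosure k) (x : AffineTrunc F n) :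
    IsIota F hα βn (AlgEquiv.restrictNormalHom (dynField (affinePoly F a b) n 0) τ) x ↔
      τ α = α + torsionAction F a n (Multiplicative.toAdd x.left) βn ∧
      ∀ z : carlitzTorsion F a n, τ z = torsionAction F a n (x.right : TruncPoly F n) z := by
  constructor
  · rintro ⟨h1, h2⟩
    simp only [AlgEquiv.restrictNormalHom_apply] at h1 h2
    exact ⟨h1, h2⟩
  · rintro ⟨h1, h2⟩
    constructor <;> simpa only [AlgEquiv.restrictNormalHom_apply]

theorem IsIota.mul {βn : carlitzTorsion F a n} {σ τ : dynGal (affinePoly F a b) n 0}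
    {x y : AffineTrunc F n} (hσ : IsIota F hα βn σ x) (hτ : IsIota F hα βn τ y) :
    IsIota F hα βn (σ * τ) (x * y) := by
  obtain ⟨σ, rfl⟩ := AlgEquiv.restrictNormalHom_surjective (AlgebraicClosure k) σ
  obtain ⟨τ, rfl⟩ := AlgEquiv.restrictNormalHom_surjective (AlgebraicClosure k) τ
  rw [← map_mul]
  rw [isIota_restrictNormalHom_iff] at hσ hτ ⊢
  constructor
  · have hleft : Multiplicative.toAdd (x * y).left =
        Multiplicative.toAdd x.left + x.right * Multiplicative.toAdd y.left := rfl
    rw [AlgEquiv.mul_apply, hτ.1, map_add, hσ.1, hσ.2, hleft, map_add, LinearMap.add_apply,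
      torsionAction_mul_apply]
    simp [add_assoc]
  · intro z
    rw [AlgEquiv.mul_apply, hτ.2, hσ.2, SemidirectProduct.mul_right, Units.val_mul,
      torsionAction_mul_apply]

theorem IsIota.eq_of_eq {βn : carlitzTorsion F a n} {σ τ : dynGal (affinePoly F a b) n 0}
    {x : AffineTrunc F n} (hσ : IsIota F hα βn σ x) (hτ : IsIota F hα βn τ x) : σ = τ := by
  obtain ⟨σ, rfl⟩ := AlgEquiv.restrictNormalHom_surjective (AlgebraicClosure k) σ
  obtain ⟨τ, rfl⟩ := AlgEquiv.restrictNormalHom_surjective (AlgebraicClosure k) τ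
  rw [isIota_restrictNormalHom_iff] at hσ hτ
  ext ⟨z, hz⟩
  rw [AlgEquiv.restrictNormalHom_apply, AlgEquiv.restrictNormalHom_apply]
  induction hz using adjoin_induction with
  | mem γ hγ =>
    have hz := (mem_dynPreimage_iff_sub_mem hα).1 hγ
    change σ γ = τ γ
    -- Each generator is `α` plus an element of `ker Lⁿ`, and the pair determines both images.
    rw [← add_sub_cancel α γ, map_add, map_add, hσ.1, hτ.1, hσ.2 ⟨_, hz⟩, hτ.2 ⟨_, hz⟩]
  | algebraMap x => simp
  | add x y _ _ hx hy => simp_all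
  | inv x _ hx => simp_all
  | mul x y _ _ hx hy => simp_all

end Galois

/-! ### Generating `R ⋊ R^×` -/

theorem Subgroup.eq_top_of_units_semidirect {R : Type*} [CommRing R]
    (hR : ∀ r : R, IsUnit r ∨ IsUnit (r - 1))
    {S : Subgroup (Multiplicative R ⋊[unitsMulAut R] Rˣ)}
    (hright : ∀ u : Rˣ, ∃ x ∈ S, x.right = u)
    (hleft : ∃ x ∈ S, x.right = 1 ∧ IsUnit (Multiplicative.toAdd x.left)) : S = ⊤ := by
  have hunit (v : Rˣ) : SemidirectProduct.inl (Multiplicative.ofAdd (v : R)) ∈ S := by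
    obtain ⟨x, hxS, hx, w, hw⟩ := hleft
    -- Conjugating the translation by `w` with an element of multiplier `v w⁻¹` gives the
    -- translation by `v`; the translation part of `y` cancels because translations commute.
    obtain ⟨y, hyS, hy⟩ := hright (v * w⁻¹)
    convert S.mul_mem (S.mul_mem hyS hxS) (S.inv_mem hyS) using 1
    have hx' : x = SemidirectProduct.inl (Multiplicative.ofAdd (w : R)) := by
      ext
      · simp [hw]
      · simp [hx]
    rw [← SemidirectProduct.inl_left_mul_inr_right y, hx', hy, mul_assoc (_ * _), mul_assoc,
      ← mul_assoc (SemidirectProduct.inr _), mul_inv_rev, ← mul_assoc _ (SemidirectProduct.inr _)⁻¹,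
      ← map_inv (SemidirectProduct.inr (φ := unitsMulAut R)), ← SemidirectProduct.inl_aut,
      ← map_inv, ← map_mul, ← map_mul]
    have haut : (unitsMulAut R (v * w⁻¹)) (Multiplicative.ofAdd (w : R)) =
        Multiplicative.ofAdd (((v * w⁻¹ : Rˣ) : R) * (w : R)) := rfl
    rw [haut, mul_comm _ y.left⁻¹, mul_inv_cancel_left]
    simp
  have hinl (r : R) : SemidirectProduct.inl (Multiplicative.ofAdd r) ∈ S := by
    rcases hR r with ⟨v, hv⟩ | ⟨v, hv⟩
    · exact hv ▸ hunit v
    · have h := S.mul_mem (hunit v) (hunit 1)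
      rwa [← map_mul, ← ofAdd_add, hv, Units.val_one, sub_add_cancel] at h
  refine (Subgroup.eq_top_iff' S).2 fun x => ?_
  obtain ⟨y, hyS, hy⟩ := hright x.right
  have h := S.mul_mem (hinl (Multiplicative.toAdd (x.left * y.left⁻¹))) hyS
  convert h using 1
  ext
  · simp
  · simp [hy]

/-! ### Construction and bijectivity of `ι_n` -/

section Galois

variable {F : Type*} [Field F] [Fintype F] {k : Type*} [Field k] [Algebra F k] {a b : k} {m : ℕ}
  {α : AlgebraicClosure k} (hα : α ∈ dynPreimage (affinePoly F a b) (m + 1) 0)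
  {β : ℕ → AlgebraicClosure k} (hβ : IsTorsionTower F a β)

theorem IsIota.unique {σ : dynGal (affinePoly F a b) (m + 1) 0} {x y : AffineTrunc F (m + 1)}
    (hx : IsIota F hα ⟨β (m + 1), hβ.mem (Nat.le_add_left 1 m)⟩ σ x)
    (hy : IsIota F hα ⟨β (m + 1), hβ.mem (Nat.le_add_left 1 m)⟩ σ y) : x = y := by
  have hinj := (hβ.torsionAction_bijective m).1
  ext
  · refine Multiplicative.toAdd.injective (hinj (Subtype.ext ?_))
    exact add_left_cancel (hx.map_root.symm.trans hy.map_root)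
  · exact hinj (Subtype.ext ((hx.map_torsion _).symm.trans (hy.map_torsion _)))

theorem exists_isIota (σ : dynGal (affinePoly F a b) (m + 1) 0) :
    ∃ x, IsIota F hα ⟨β (m + 1), hβ.mem (Nat.le_add_left 1 m)⟩ σ x := by
  obtain ⟨τ, rfl⟩ := AlgEquiv.restrictNormalHom_surjective (AlgebraicClosure k) σ
  obtain ⟨hinj, hsurj⟩ := hβ.torsionAction_bijective m
  set βn : carlitzTorsion F a (m + 1) := ⟨β (m + 1), hβ.mem (Nat.le_add_left 1 m)⟩
  have key (τ : AlgebraicClosure k ≃ₐ[k] AlgebraicClosure k) :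
      ∃ r : TruncPoly F (m + 1), ∀ z : carlitzTorsion F a (m + 1),
        τ z = torsionAction F a (m + 1) r z := by
    -- The multiplier is read off from the generator `β_n`; commutativity of `R_n` extends it to all
    -- of `ker Lⁿ`. The multiplier of `τ⁻¹` supplies its inverse.
    obtain ⟨r, hr⟩ := hsurj ⟨τ βn, algEquiv_mem_carlitzTorsion τ βn.2⟩
    refine ⟨r, fun z => ?_⟩
    obtain ⟨p, rfl⟩ := hsurj z
    dsimp only at hr ⊢
    rw [algEquiv_torsionAction, ← hr, ← torsionAction_mul_apply, ← torsionAction_mul_apply,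
      mul_comm]
  have hinv {τ τ' : AlgebraicClosure k ≃ₐ[k] AlgebraicClosure k} (hτ : τ * τ' = 1)
      {r r' : TruncPoly F (m + 1)}
      (hr : ∀ z : carlitzTorsion F a (m + 1), τ z = torsionAction F a (m + 1) r z)
      (hr' : ∀ z : carlitzTorsion F a (m + 1), τ' z = torsionAction F a (m + 1) r' z) :
      r * r' = 1 := by
    refine hinj (Subtype.ext ?_)
    dsimp only
    rw [torsionAction_mul_apply, ← hr, ← hr', ← AlgEquiv.mul_apply, hτ, map_one]
    rfl
  obtain ⟨u, hu⟩ := key τ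
  obtain ⟨v, hv⟩ := key τ⁻¹
  obtain ⟨r, hr⟩ := hsurj ⟨τ α - α,
    (mem_dynPreimage_iff_sub_mem hα).1 (algEquiv_mem_dynPreimage hα τ)⟩
  refine ⟨⟨Multiplicative.ofAdd r, ⟨u, v, hinv (mul_inv_cancel τ) hu hv,
    hinv (inv_mul_cancel τ) hv hu⟩⟩, (isIota_restrictNormalHom_iff hα _ _ _).2 ⟨?_, hu⟩⟩
  have h := congrArg Subtype.val hr
  dsimp only at h
  rw [toAdd_ofAdd, h, add_sub_cancel]

/-- For every unit `v`, `v β_n` is a root of the irreducible `Lⁿ / Lᵐ`, so `β_n` and `u β_n` are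
conjugate over `k`. -/
theorem exists_isIota_right_eq (hirr : Irreducible (linIterQuot (Fintype.card F) a m))
    (u : (TruncPoly F (m + 1))ˣ) :
    ∃ σ x, IsIota F hα ⟨β (m + 1), hβ.mem (Nat.le_add_left 1 m)⟩ σ x ∧ x.right = u := by
  set βn : carlitzTorsion F a (m + 1) := ⟨β (m + 1), hβ.mem (Nat.le_add_left 1 m)⟩ with hβn
  have hroot (v : (TruncPoly F (m + 1))ˣ) :
      minpoly k (torsionAction F a (m + 1) (v : TruncPoly F (m + 1)) βn : AlgebraicClosure k) =
        linIterQuot (Fintype.card F) a m :=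
    (minpoly.eq_of_irreducible_of_monic hirr
      (aeval_linIterQuot_eq_zero (Subtype.mem _) ((hβ.isUnit_iff m _).1 v.isUnit))
      (monic_linIterQuot Fintype.one_lt_card a m)).symm
  obtain ⟨τ, hτ⟩ := isConjRoot_iff_exists_algEquiv.1 ((hroot u).trans (hroot 1).symm)
  obtain ⟨x, hx⟩ := exists_isIota hα hβ (AlgEquiv.restrictNormalHom _ τ)
  refine ⟨_, x, hx, Units.ext ((hβ.torsionAction_bijective m).1 (Subtype.ext ?_))⟩
  rw [isIota_restrictNormalHom_iff] at hx
  rw [Units.val_one, map_one, Module.End.one_apply] at hτ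
  exact (hx.2 _).symm.trans hτ

/-- The root `γ` of `f` is separable because `f' = a ≠ 0`, so outside `k(β_n)` it has another
conjugate over that field. An automorphism moving it there fixes `β_n`, hence has `F = 1`; it moves
`γ` by `Lᵐ(G(L)(β_n))`, which is nonzero exactly when `G` is a unit. -/
theorem exists_isIota_right_eq_one (ha : a ≠ 0)
    (hγ : aeval α ((affinePoly F a b).comp^[m] X) ∉ k⟮β (m + 1)⟯) :
    ∃ σ x, IsIota F hα ⟨β (m + 1), hβ.mem (Nat.le_add_left 1 m)⟩ σ x ∧ x.right = 1 ∧
      IsUnit (Multiplicative.toAdd x.left) := by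
  set γ := aeval α ((affinePoly F a b).comp^[m] X) with hγdef
  have hroot : aeval γ (affinePoly F a b) = 0 := by
    have h := hα
    simp only [dynPreimage, map_zero, Set.mem_ofPred_eq, Function.iterate_succ_apply',
      aeval_comp] at h
    exact h
  have hsep : IsSeparable k⟮β (m + 1)⟯ γ := by
    refine ((separable_affinePoly F ha b).map (f := algebraMap k k⟮β (m + 1)⟯)).of_dvd
      (minpoly.dvd _ _ ?_)
    rw [aeval_map_algebraMap, hroot]
  have hbot : γ ∉ (⊥ : Subalgebra k⟮β (m + 1)⟯ (AlgebraicClosure k)) := by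
    rintro ⟨y, hy⟩
    exact hγ (hy ▸ y.2)
  have hnormal : Normal k⟮β (m + 1)⟯ (AlgebraicClosure k) := Normal.tower_top_of_normal k _ _
  obtain ⟨y, hne, hy⟩ := (notMem_iff_exists_ne_and_isConjRoot hsep (IsAlgClosed.splits _)).1 hbot
  obtain ⟨τ, hτ⟩ := isConjRoot_iff_exists_algEquiv.1 hy.symm
  set τ' := τ.restrictScalars k with hτ'
  have hfix : τ' (β (m + 1)) = β (m + 1) := τ.commutes ⟨_, mem_adjoin_simple_self k _⟩
  have hmove : τ' γ ≠ γ := fun h => hne (h.symm.trans hτ)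
  obtain ⟨x, hx⟩ := exists_isIota hα hβ (AlgEquiv.restrictNormalHom _ τ')
  refine ⟨_, x, hx, Units.ext ((hβ.torsionAction_bijective m).1 (Subtype.ext ?_)),
    (hβ.isUnit_iff m _).2 fun h0 => hmove ?_⟩
  · rw [isIota_restrictNormalHom_iff] at hx
    dsimp only
    rw [Units.val_one, map_one, Module.End.one_apply]
    exact (hx.2 _).symm.trans hfix
  · rw [isIota_restrictNormalHom_iff] at hx
    rw [hγdef, ← aeval_algHom_apply, hx.1, aeval_affinePoly_iterate_add, h0, add_zero]

theorem exists_mulEquiv_isIota (hirr : Irreducible (linIterQuot (Fintype.card F) a m))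
    (ha : a ≠ 0) (hγ : aeval α ((affinePoly F a b).comp^[m] X) ∉ k⟮β (m + 1)⟯) :
    ∃ ι : dynGal (affinePoly F a b) (m + 1) 0 ≃* AffineTrunc F (m + 1),
      ∀ σ x, ι σ = x ↔ IsIota F hα ⟨β (m + 1), hβ.mem (Nat.le_add_left 1 m)⟩ σ x := by
  choose g hg using exists_isIota hα hβ
  let φ : dynGal (affinePoly F a b) (m + 1) 0 →* AffineTrunc F (m + 1) :=
    MonoidHom.mk' g fun σ τ => IsIota.unique hα hβ (hg _) ((hg σ).mul hα (hg τ))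
  have hφ (σ x) : φ σ = x ↔
      IsIota F hα ⟨β (m + 1), hβ.mem (Nat.le_add_left 1 m)⟩ σ x :=
    ⟨fun h => h ▸ hg σ, IsIota.unique hα hβ (hg σ)⟩
  have hsurj : φ.range = ⊤ := by
    refine Subgroup.eq_top_of_units_semidirect TruncPoly.isUnit_or_isUnit_sub_one (fun u => ?_) ?_
    · obtain ⟨σ, x, hx, hu⟩ := exists_isIota_right_eq hα hβ hirr u
      exact ⟨x, ⟨σ, (hφ σ x).2 hx⟩, hu⟩
    · obtain ⟨σ, x, hx, h⟩ := exists_isIota_right_eq_one hα hβ ha hγ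
      exact ⟨x, ⟨σ, (hφ σ x).2 hx⟩, h⟩
  exact ⟨MulEquiv.ofBijective φ ⟨fun σ τ h => (hg σ).eq_of_eq hα ((hφ τ _).1 h.symm),
    MonoidHom.range_eq_top.1 hsurj⟩, hφ⟩

end Galois

/-! ### A degree comparison -/

/-- When `γ ∈ k(β)`, both `[k(β) : k]` and `[k(β) : k(γ)]` equal `deg p`, so the tower law forces
`[k(γ) : k] = 1`. -/
theorem IntermediateField.mem_bot_of_irreducible_map {k E : Type*} [Field k] [Field E]
    [Algebra k E] {γ β : E} {p : k[X]} (hm : p.Monic) (hβ : aeval β p = 0) (hp : Irreducible p)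
    (hp' : Irreducible (p.map (algebraMap k k⟮γ⟯))) (hγ : γ ∈ k⟮β⟯) :
    γ ∈ (⊥ : IntermediateField k E) := by
  have hint : IsIntegral k β := ⟨p, hm, hβ⟩
  have h1 : Module.finrank k k⟮β⟯ = p.natDegree := by
    rw [adjoin.finrank hint, minpoly.eq_of_irreducible_of_monic hp hβ hm]
  have hβ' : aeval β (p.map (algebraMap k k⟮γ⟯)) = 0 := by rw [aeval_map_algebraMap, hβ]
  have h2 : Module.finrank k⟮γ⟯ k⟮γ⟯⟮β⟯ = p.natDegree := by
    rw [adjoin.finrank hint.tower_top,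
      ← minpoly.eq_of_irreducible_of_monic hp' hβ' (hm.map _), natDegree_map]
  have h3 : k⟮γ⟯⟮β⟯.restrictScalars k = k⟮β⟯ := by
    rw [adjoin_simple_adjoin_simple]
    refine le_antisymm (adjoin_le_iff.2 ?_) (adjoin.mono _ _ _ (by simp))
    rintro x (rfl | rfl)
    · exact hγ
    · exact mem_adjoin_simple_self k _
  have h4 : Module.finrank k k⟮γ⟯⟮β⟯ = p.natDegree := by
    rw [← h1, ← h3]; rfl
  have h5 := Module.finrank_mul_finrank k k⟮γ⟯ k⟮γ⟯⟮β⟯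
  rw [h2, h4] at h5
  exact finrank_adjoin_simple_eq_one_iff.1
    (Nat.eq_of_mul_eq_mul_right hp.natDegree_pos (h5.trans (one_mul _).symm))

/-! ### Generic `t` and `s`: adjoining a root of `f` gives a copy of `K(t, s)` -/

section Generic

variable {F : Type*} [Field F] [Fintype F] {K : Type*} [Field K]

theorem varT_ne_zero : varT K ≠ 0 := by
  rw [varT, Ne, FaithfulSMul.algebraMap_eq_zero_iff]
  exact MvPolynomial.X_ne_zero 0

theorem irreducible_linIterQuot_varT {q : ℕ} (hq : 2 ≤ q) (m : ℕ) :
    Irreducible (linIterQuot q (varT K) m) := by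
  have h := irreducible_linIterQuot hq (MvPolynomial.X_prime (R := K) (i := (0 : Fin 2))) m
  rw [(monic_linIterQuot hq _ m).irreducible_iff_irreducible_map_fraction_map
    (K := RatFuncTS K), map_linIterQuot] at h
  exact h

/-- A root would be integral over the integrally closed ring `K[t, s]`, hence a polynomial. Setting
`t = 0` would make `-s` a `q`-th power in `K[s]`, impossible by degree. -/
theorem eval_affinePoly_generic_ne_zero (x : RatFuncTS K) :
    eval x (affinePoly F (varT K) (varS K)) ≠ 0 := by
  intro hx
  have hq : 1 < Fintype.card F := Fintype.one_lt_card
  simp only [affinePoly, varT, varS, eval_add, eval_pow, eval_X, eval_mul, eval_C] at hx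
  have hint : IsIntegral (MvPolynomial (Fin 2) K) x := by
    refine ⟨X ^ Fintype.card F + C (.X 0) * X + C (.X 1), ?_, by simpa using hx⟩
    rw [add_assoc]
    exact monic_X_pow_add (degree_linear_le.trans_lt (by exact_mod_cast hq))
  obtain ⟨g, rfl⟩ := IsIntegrallyClosed.algebraMap_eq_of_integral hint
  rw [← map_pow, ← map_mul, ← map_add, ← map_add, FaithfulSMul.algebraMap_eq_zero_iff] at hx
  have h := congrArg (MvPolynomial.aeval ![(0 : K[X]), X]) hx
  simp only [map_add, map_mul, map_pow, MvPolynomial.aeval_X, Matrix.cons_val_zero,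
    Matrix.cons_val_one, zero_mul, add_zero, map_zero] at h
  have hdeg := congrArg natDegree (eq_neg_of_add_eq_zero_left h)
  rw [natDegree_pow, natDegree_neg, natDegree_X] at hdeg
  exact hq.ne' (Nat.dvd_one.1 ⟨_, hdeg.symm⟩)

/-- The endomorphism of `K[t, s]` that fixes `t` and sends `s` to `-(s^q + t s)`. -/
def substS (K : Type*) [Field K] (q : ℕ) :
    MvPolynomial (Fin 2) K →ₐ[K] MvPolynomial (Fin 2) K :=
  MvPolynomial.aeval ![.X 0, -(.X 1 ^ q + .X 0 * .X 1)]

/-- The image contains `t` and `-(s^q + ts)`, so `s` is a root of a monic polynomial over it. -/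
theorem isIntegral_range_substS {q : ℕ} (hq : 2 ≤ q) :
    Algebra.IsIntegral (substS K q).range (MvPolynomial (Fin 2) K) := by
  set A := (substS K q).range
  have h0 : (.X 0 : MvPolynomial (Fin 2) K) ∈ A := ⟨.X 0, by simp [substS]⟩
  have h1 : (-(.X 1 ^ q + .X 0 * .X 1) : MvPolynomial (Fin 2) K) ∈ A :=
    ⟨.X 1, by simp [substS]⟩
  have hX0 : IsIntegral A (.X 0 : MvPolynomial (Fin 2) K) :=
    isIntegral_algebraMap (R := A) (x := ⟨_, h0⟩)
  have hX1 : IsIntegral A (.X 1 : MvPolynomial (Fin 2) K) := by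
    refine ⟨X ^ q + (C ⟨_, h0⟩ * X + C ⟨_, h1⟩),
      monic_X_pow_add (degree_linear_le.trans_lt (by exact_mod_cast hq)), ?_⟩
    simp only [eval₂_add, eval₂_mul, eval₂_pow, eval₂_X, eval₂_C, Subalgebra.algebraMap_apply]
    ring
  refine ⟨fun p => ?_⟩
  induction p using MvPolynomial.induction_on with
  | C c => exact isIntegral_algebraMap (R := A) (x := algebraMap K A c)
  | add p q hp hq => exact hp.add hq
  | mul_X p i hp =>
    refine hp.mul ?_
    fin_cases i
    · exact hX0
    · exact hX1

section Root

variable {γ : AlgebraicClosure (RatFuncTS K)}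

/-- The homomorphism `K[t, s] → K(t, s)(γ)` with `t ↦ t` and `s ↦ γ`. -/
def evalRoot (γ : AlgebraicClosure (RatFuncTS K)) :
    MvPolynomial (Fin 2) K →ₐ[K] (RatFuncTS K)⟮γ⟯ :=
  MvPolynomial.aeval ![algebraMap _ _ (varT K), AdjoinSimple.gen _ γ]

variable (hγ : aeval γ (affinePoly F (varT K) (varS K)) = 0)
include hγ

omit [Field F] in
-- The relation `s = -(γ^q + tγ)` says that substituting `s ↦ -(s^q + ts)` and then `s ↦ γ` recovers
-- the original `s`.
theorem evalRoot_substS (p : MvPolynomial (Fin 2) K) :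
    evalRoot γ (substS K (Fintype.card F) p) =
      algebraMap (RatFuncTS K) (RatFuncTS K)⟮γ⟯ (algebraMap _ _ p) := by
  have hgen : aeval (AdjoinSimple.gen (RatFuncTS K) γ) (affinePoly F (varT K) (varS K)) = 0 := by
    refine (algebraMap (RatFuncTS K)⟮γ⟯ (AlgebraicClosure (RatFuncTS K))).injective ?_
    rw [← aeval_algebraMap_apply, AdjoinSimple.algebraMap_gen, hγ, map_zero]
  simp only [affinePoly, map_add, map_mul, map_pow, aeval_X, aeval_C] at hgen
  induction p using MvPolynomial.induction_on with
  | C c =>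
    rw [← MvPolynomial.algebraMap_eq, AlgHom.commutes, AlgHom.commutes,
      ← IsScalarTower.algebraMap_apply K (MvPolynomial (Fin 2) K) (RatFuncTS K),
      ← IsScalarTower.algebraMap_apply K (RatFuncTS K)]
  | add p q hp hq => simp only [map_add, hp, hq]
  | mul_X p i hp =>
    rw [map_mul, map_mul, map_mul, map_mul, hp]
    congr 1
    fin_cases i
    · simp [evalRoot, substS, varT]
    · have h : evalRoot γ (substS K (Fintype.card F) (.X 1)) =
          -(AdjoinSimple.gen _ γ ^ Fintype.card F +
            algebraMap _ _ (varT K) * AdjoinSimple.gen (RatFuncTS K) γ) := by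
        simp [evalRoot, substS]
      exact h.trans (neg_eq_of_add_eq_zero_right hgen)

/-- The kernel meets the image of `substS` only in zero, and a nonzero ideal in an integral
extension of domains has nonzero contraction. -/
theorem evalRoot_injective : Function.Injective (evalRoot γ) := by
  have hint := isIntegral_range_substS (K := K) (q := Fintype.card F) Fintype.one_lt_card
  refine (RingHom.injective_iff_ker_eq_bot (evalRoot γ).toRingHom).2
    (Ideal.eq_bot_of_comap_eq_bot (R := (substS K (Fintype.card F)).range) (eq_bot_iff.2 ?_))
  rintro ⟨_, p, rfl⟩ hp
  have hp' : evalRoot γ (substS K (Fintype.card F) p) = 0 := hp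
  rw [evalRoot_substS hγ, map_eq_zero_iff _ (algebraMap (RatFuncTS K) (RatFuncTS K)⟮γ⟯).injective,
    FaithfulSMul.algebraMap_eq_zero_iff] at hp'
  subst hp'
  exact Subtype.ext (map_zero (substS K (Fintype.card F)))

theorem exists_ringEquiv_adjoin_root :
    ∃ ψ : RatFuncTS K ≃+* (RatFuncTS K)⟮γ⟯, ψ (varT K) = algebraMap _ _ (varT K) := by
  let ψ : RatFuncTS K →+* (RatFuncTS K)⟮γ⟯ :=
    IsFractionRing.lift (g := (evalRoot γ).toRingHom) (evalRoot_injective hγ)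
  have hψ (p : MvPolynomial (Fin 2) K) : ψ (algebraMap _ _ p) = evalRoot γ p :=
    IsFractionRing.lift_algebraMap _ p
  have hrange (z : (RatFuncTS K)⟮γ⟯) : z ∈ ψ.fieldRange := by
    obtain ⟨z, hz⟩ := z
    induction hz using adjoin_induction with
    | mem x hx =>
      obtain rfl := Set.mem_singleton_iff.1 hx
      exact ⟨varS K, (hψ _).trans (by simp [evalRoot]; rfl)⟩
    | algebraMap x =>
      obtain ⟨p, q, -, rfl⟩ := IsFractionRing.div_surjective (A := MvPolynomial (Fin 2) K) x
      -- A preimage of `p / q` comes from replacing `s` by `-(s^q + ts)` (exponent `#F`) in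
      -- numerator and denominator.
      refine ⟨algebraMap _ _ (substS K (Fintype.card F) p) /
        algebraMap _ _ (substS K (Fintype.card F) q), ?_⟩
      rw [map_div₀, hψ, hψ, evalRoot_substS hγ, evalRoot_substS hγ, ← map_div₀]
      rfl
    | add x y _ _ hx hy => exact add_mem hx hy
    | inv x _ hx => exact inv_mem hx
    | mul x y _ _ hx hy => exact mul_mem hx hy
  exact ⟨RingEquiv.ofBijective ψ ⟨ψ.injective, hrange⟩, (hψ _).trans (by simp [evalRoot])⟩

theorem notMem_adjoin_of_aeval_linIterQuot_eq_zero {m : ℕ} {β : AlgebraicClosure (RatFuncTS K)}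
    (hβ : aeval β (linIterQuot (Fintype.card F) (varT K) m) = 0) : γ ∉ (RatFuncTS K)⟮β⟯ := by
  intro hmem
  have hq : 2 ≤ Fintype.card F := Fintype.one_lt_card
  have hirr := irreducible_linIterQuot_varT (K := K) hq m
  obtain ⟨ψ, hψ⟩ := exists_ringEquiv_adjoin_root hγ
  have hirr' : Irreducible ((linIterQuot (Fintype.card F) (varT K) m).map
      (algebraMap (RatFuncTS K) (RatFuncTS K)⟮γ⟯)) := by
    -- The coefficients involve `t` alone, which `ψ` fixes, so irreducibility over `k` transfers to
    -- `k(γ)`.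
    have h := (MulEquiv.irreducible_iff (Polynomial.mapEquiv ψ)).2 hirr
    rwa [mapEquiv_apply, map_linIterQuot, RingEquiv.coe_toRingHom, hψ,
      ← map_linIterQuot (algebraMap (RatFuncTS K) (RatFuncTS K)⟮γ⟯)] at h
  obtain ⟨x, hx⟩ := mem_bot.1
    (mem_bot_of_irreducible_map (monic_linIterQuot hq _ m) hβ hirr hirr' hmem)
  refine eval_affinePoly_generic_ne_zero (F := F) x ?_
  rw [← hx, aeval_algebraMap_apply, FaithfulSMul.algebraMap_eq_zero_iff] at hγ
  simpa using hγ

end Root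

end Generic

end

theorem lemma3p1 {F : Type*} [Field F] [Fintype F] {K : Type*} [Field K] [Algebra F K]
    (n : ℕ) (hn : 1 ≤ n) (α : AlgebraicClosure (RatFuncTS K))
    (hα : α ∈ dynPreimage (affinePoly F (varT K) (varS K)) n 0) :
    dynField (affinePoly F (varT K) (varS K)) n 0 =
        dynField (carlitzPoly F (varT K)) n 0 ⊔ (RatFuncTS K)⟮α⟯ ∧
      ∀ (β : ℕ → AlgebraicClosure (RatFuncTS K)) (hβ : IsTorsionTower F (varT K) β),
        ∃ ι : dynGal (affinePoly F (varT K) (varS K)) n 0 ≃* AffineTrunc F n,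
          ∀ (σ : dynGal (affinePoly F (varT K) (varS K)) n 0) (x : AffineTrunc F n),
            ι σ = x ↔ IsIota F hα ⟨β n, hβ.mem hn⟩ σ x := by
  refine ⟨dynField_affinePoly_eq_sup hα, fun β hβ => ?_⟩
  obtain ⟨m, rfl⟩ := Nat.exists_eq_add_of_le' hn
  refine exists_mulEquiv_isIota hα hβ (irreducible_linIterQuot_varT Fintype.one_lt_card m)
    varT_ne_zero (notMem_adjoin_of_aeval_linIterQuot_eq_zero (F := F) (m := m) ?_
      (aeval_linIterQuot_eq_zero (hβ.mem hn) ?_))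
  · have h := hα
    simp only [dynPreimage, map_zero, Set.mem_ofPred_eq, Function.iterate_succ_apply',
      aeval_comp] at h
    exact h
  · rw [hβ.carlitzEnd_pow_apply_succ]
    exact hβ.one_ne_zero
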